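/- Let $\theta$ be an irrational real number, $\lambda=e^{2\pi i\theta}$, and let $\mathcal{O}(\mathbb{T}^2_\theta)$ be the complex $*$-algebra generated by unitaries $V,W$ subject to $VW=\lambda WV$. Let $\sigma$ be the algebra automorphism of $\mathcal{O}(\mathbb{T}^2_\theta)$ with $\sigma(V)=V^*$, $\sigma(W)=W^*$, and put $\mathcal{O}(\mathbb{P}_\theta)=\{a:\sigma(a)=a\}$ (the noncommutative pillow algebra) and $\mathcal{O}(\mathbb{T}^2_\theta)_-=\{a:\sigma(a)=-a\}$, a left and right $\mathcal{O}(\mathbb{P}_\theta)$-module by multiplication. Then: 1. $\mathcal{O}(\mathbb{T}^2_\theta)_-$ is finitely generated and projective, but not free, both as a left and as a right $\mathcal{O}(\mathbb{P}_\theta)$-module. 2. Let $\hat x=V-V^*$, $\hat y=W-W^*$, $\hat z=VW^*-V^*W$, $z=VW^*+V^*W$. The matrix $$\mathbf e=\frac{1}{2(\bar\lambda^2-1)}\begin{pmatrix}\hat x\\ \hat y\\ \hat z\end{pmatrix}\begin{pmatrix}\hat x,& \hat y-\hat xz,& -\bar\lambda\hat z\end{pmatrix}$$ is an idempotent $3\times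 3$ matrix over $\mathcal{O}(\mathbb{P}_\theta)$, and $\mathcal{O}(\mathbb{T}^2_\theta)_-\cong\mathcal{O}(\mathbb{P}_\theta)^3\,\mathbf e$ as left modules and $\mathcal{O}(\mathbb{T}^2_\theta)_-\cong\mathbf e\,\mathcal{O}(\mathbb{P}_\theta)^3$ as right modules. 3. For $i,j\in\{0,1\}$ there is a unique linear functional $\hat\tau_{ij}$ on $\mathcal{O}(\mathbb{T}^2_\theta)$ such that, for all $\alpha,\beta\in\mathbb{Z}$, $\hat\tau_{ij}(V^\alpha W^\beta)=e^{\pi i\theta\alpha\beta}$ if $\alpha\equiv i$ and $\beta\equiv j$ modulo $2$, and $\hat\tau_{ij}(V^\alpha W^\beta)=0$ otherwise. It is a twisted trace, i.e. $\hat\tau_{ij}(ab)=\hat\tau_{ij}(\sigma(b)a)$ for all $a,b$, and $$\hat\tau_{00}(\operatorname{Tr}\mathbf e)=-1,\qquad \hat\tau_{01}(\operatorname{Tr}\mathbf e)=\hat\tau_{10}(\operatorname{Tr}\mathbf e)=\hat\tau_{11}(\operatorname{Tr}\mathbf e)=0 .$$ 4. The module of one-forms $\Omega^1(\mathbb{P}_\theta)=\mathcal{O}(\mathbb{T}^2_\theta)_-\oplus\mathcal{O}(\mathbb{T}^2_\theta)_-$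 (the sections of the cotangent bundle of $\mathbb{P}_\theta$) is non-trivial: it is not free, neither as a left nor as a right $\mathcal{O}(\mathbb{P}_\theta)$-module. -/

import Mathlib

namespace NCPillow

noncomputable section

/-- The deformation parameter `λ = exp(2πiθ)`. -/
def lam (θ : ℝ) : ℂ := Complex.exp (2 * Real.pi * Complex.I * θ)

/-- Letters for the unitaries `V`, `W` and their adjoints. -/
inductive Gen : Type
  | V
  | Vs
  | W
  | Ws

/-- Defining relations of the noncommutative torus: `V V* = V* V = 1`, `W W* = W* W = 1` and
`V W = λ W V`. -/
inductive Rel (θ : ℝ) : FreeAlgebra ℂ Gen → FreeAlgebra ℂ Gen → Prop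
  | V_mul_Vs : Rel θ (FreeAlgebra.ι ℂ Gen.V * FreeAlgebra.ι ℂ Gen.Vs) 1
  | Vs_mul_V : Rel θ (FreeAlgebra.ι ℂ Gen.Vs * FreeAlgebra.ι ℂ Gen.V) 1
  | W_mul_Ws : Rel θ (FreeAlgebra.ι ℂ Gen.W * FreeAlgebra.ι ℂ Gen.Ws) 1
  | Ws_mul_W : Rel θ (FreeAlgebra.ι ℂ Gen.Ws * FreeAlgebra.ι ℂ Gen.W) 1
  | V_mul_W : Rel θ (FreeAlgebra.ι ℂ Gen.V * FreeAlgebra.ι ℂ Gen.W)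
      (lam θ • (FreeAlgebra.ι ℂ Gen.W * FreeAlgebra.ι ℂ Gen.V))

/-- The coordinate algebra `𝒪(𝕋²_θ)` of the noncommutative torus. The `*`-conjugate of the relation
`V W = λ W V` follows from the other relations, so this is the algebra underlying the universal
`*`-algebra generated by unitaries `V`, `W` with `V W = λ W V`; the involution is determined by
`V* = V⁻¹`, `W* = W⁻¹`. -/
def Torus (θ : ℝ) : Type := RingQuot (Rel θ)

instance torusRing (θ : ℝ) : Ring (Torus θ) := inferInstanceAs (Ring (RingQuot (Rel θ)))

instance torusAlgebra (θ : ℝ) : Algebra ℂ (Torus θ) :=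
  inferInstanceAs (Algebra ℂ (RingQuot (Rel θ)))

/-- The quotient map from the free algebra onto the noncommutative torus. -/
def mk (θ : ℝ) : FreeAlgebra ℂ Gen →ₐ[ℂ] Torus θ := RingQuot.mkAlgHom ℂ (Rel θ)

theorem mk_rel {θ : ℝ} {x y : FreeAlgebra ℂ Gen} (h : Rel θ x y) : mk θ x = mk θ y :=
  RingQuot.mkAlgHom_rel ℂ h

/-- An algebra map out of the noncommutative torus is given by images of the letters that satisfy
the defining relations. -/
def lift {B : Type*} [Ring B] [Algebra ℂ B] (θ : ℝ) (f : Gen → B)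
    (hf : ∀ ⦃x y : FreeAlgebra ℂ Gen⦄, Rel θ x y → FreeAlgebra.lift ℂ f x = FreeAlgebra.lift ℂ f y) :
    Torus θ →ₐ[ℂ] B :=
  RingQuot.liftAlgHom ℂ (s := Rel θ) ⟨FreeAlgebra.lift ℂ f, hf⟩

/-- The image of a letter in the noncommutative torus. -/
def gen (θ : ℝ) (g : Gen) : Torus θ := mk θ (FreeAlgebra.ι ℂ g)

theorem lift_gen {B : Type*} [Ring B] [Algebra ℂ B] (θ : ℝ) (f : Gen → B)
    (hf : ∀ ⦃x y : FreeAlgebra ℂ Gen⦄, Rel θ x y → FreeAlgebra.lift ℂ f x = FreeAlgebra.lift ℂ f y)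
    (g : Gen) : lift θ f hf (gen θ g) = f g :=
  (RingQuot.liftAlgHom_mkAlgHom_apply ℂ (FreeAlgebra.lift ℂ f) hf (FreeAlgebra.ι ℂ g)).trans
    (FreeAlgebra.lift_ι_apply f g)

theorem gen_V_Vs (θ : ℝ) : gen θ Gen.V * gen θ Gen.Vs = 1 := by
  simpa [gen] using mk_rel (Rel.V_mul_Vs (θ := θ))

theorem gen_Vs_V (θ : ℝ) : gen θ Gen.Vs * gen θ Gen.V = 1 := by
  simpa [gen] using mk_rel (Rel.Vs_mul_V (θ := θ))

theorem gen_W_Ws (θ : ℝ) : gen θ Gen.W * gen θ Gen.Ws = 1 := by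
  simpa [gen] using mk_rel (Rel.W_mul_Ws (θ := θ))

theorem gen_Ws_W (θ : ℝ) : gen θ Gen.Ws * gen θ Gen.W = 1 := by
  simpa [gen] using mk_rel (Rel.Ws_mul_W (θ := θ))

theorem gen_V_W (θ : ℝ) : gen θ Gen.V * gen θ Gen.W = lam θ • (gen θ Gen.W * gen θ Gen.V) := by
  simpa [gen] using mk_rel (Rel.V_mul_W (θ := θ))

/-- The unitary generator `V`, as a unit; `V* = V⁻¹`. -/
def V (θ : ℝ) : (Torus θ)ˣ := ⟨gen θ Gen.V, gen θ Gen.Vs, gen_V_Vs θ, gen_Vs_V θ⟩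

/-- The unitary generator `W`, as a unit; `W* = W⁻¹`. -/
def W (θ : ℝ) : (Torus θ)ˣ := ⟨gen θ Gen.W, gen θ Gen.Ws, gen_W_Ws θ, gen_Ws_W θ⟩

theorem gen_Vs_Ws (θ : ℝ) :
    gen θ Gen.Vs * gen θ Gen.Ws = lam θ • (gen θ Gen.Ws * gen θ Gen.Vs) := by
  have h : ((V θ * W θ : (Torus θ)ˣ) : Torus θ) = lam θ • ((W θ * V θ : (Torus θ)ˣ) : Torus θ) :=
    gen_V_W θ
  have h1 : (((W θ * V θ)⁻¹ : (Torus θ)ˣ) : Torus θ)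
      = lam θ • (((V θ * W θ)⁻¹ : (Torus θ)ˣ) : Torus θ) := by
    calc (((W θ * V θ)⁻¹ : (Torus θ)ˣ) : Torus θ)
        = ((W θ * V θ)⁻¹ : (Torus θ)ˣ) * ((V θ * W θ : (Torus θ)ˣ) : Torus θ)
            * (((V θ * W θ)⁻¹ : (Torus θ)ˣ) : Torus θ) := by
          rw [mul_assoc, Units.mul_inv, mul_one]
      _ = _ := by
          rw [h, mul_smul_comm, Units.inv_mul, smul_mul_assoc, one_mul]
  rw [mul_inv_rev, mul_inv_rev] at h1
  exact h1

/-- The interchange of `V` with `V*` and of `W` with `W*` on letters. -/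
def Gen.swap : Gen → Gen
  | Gen.V => Gen.Vs
  | Gen.Vs => Gen.V
  | Gen.W => Gen.Ws
  | Gen.Ws => Gen.W

/-- The algebra map `σ` of the noncommutative torus with `σ(V) = V*`, `σ(W) = W*`. -/
def sigma (θ : ℝ) : Torus θ →ₐ[ℂ] Torus θ :=
  lift θ (fun g => gen θ g.swap) (by
    intro x y h
    cases h <;>
      simp [Gen.swap, gen_V_Vs, gen_Vs_V, gen_W_Ws, gen_Ws_W, gen_Vs_Ws])

/-- The coordinate algebra `𝒪(ℙ_θ) = 𝒪(𝕋²_θ)₊` of the noncommutative pillow: the fixed points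
of `σ`. -/
def Pillow (θ : ℝ) : Subalgebra ℂ (Torus θ) := AlgHom.equalizer (sigma θ) (AlgHom.id ℂ (Torus θ))

theorem mem_pillow {θ : ℝ} {a : Torus θ} : a ∈ Pillow θ ↔ sigma θ a = a := Iff.rfl

/-- The odd part `𝒪(𝕋²_θ)₋ = {a | σ(a) = -a}`. -/
def OddPart (θ : ℝ) : Submodule ℂ (Torus θ) where
  carrier := {a | sigma θ a = -a}
  add_mem' {a b} ha hb := by
    change sigma θ (a + b) = -(a + b)
    change sigma θ a = -a at ha
    change sigma θ b = -b at hb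
    rw [map_add, ha, hb, neg_add]
  zero_mem' := by simp
  smul_mem' c a ha := by
    change sigma θ (c • a) = -(c • a)
    change sigma θ a = -a at ha
    rw [map_smul, ha, smul_neg]

theorem mem_odd {θ : ℝ} {a : Torus θ} : a ∈ OddPart θ ↔ sigma θ a = -a := Iff.rfl

theorem pillow_mul_odd {θ : ℝ} {p a : Torus θ} (hp : p ∈ Pillow θ) (ha : a ∈ OddPart θ) :
    p * a ∈ OddPart θ := by
  rw [mem_pillow] at hp
  rw [mem_odd] at ha ⊢
  rw [map_mul, hp, ha, mul_neg]

theorem odd_mul_pillow {θ : ℝ} {p a : Torus θ} (hp : p ∈ Pillow θ) (ha : a ∈ OddPart θ) :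
    a * p ∈ OddPart θ := by
  rw [mem_pillow] at hp
  rw [mem_odd] at ha ⊢
  rw [map_mul, hp, ha, neg_mul]

theorem odd_mul_odd {θ : ℝ} {a b : Torus θ} (ha : a ∈ OddPart θ) (hb : b ∈ OddPart θ) :
    a * b ∈ Pillow θ := by
  rw [mem_odd] at ha hb
  rw [mem_pillow, map_mul, ha, hb, neg_mul_neg]

/-- `𝒪(𝕋²_θ)₋` as a left `𝒪(ℙ_θ)`-module: `p • a = p a`. -/
instance leftModule (θ : ℝ) : Module (Pillow θ) (OddPart θ) where
  smul p a := ⟨(p : Torus θ) * (a : Torus θ), pillow_mul_odd p.2 a.2⟩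
  one_smul a := Subtype.ext (one_mul (a : Torus θ))
  mul_smul p q a := Subtype.ext (mul_assoc (p : Torus θ) (q : Torus θ) (a : Torus θ))
  smul_zero p := Subtype.ext (mul_zero (p : Torus θ))
  smul_add p a b := Subtype.ext (mul_add (p : Torus θ) (a : Torus θ) (b : Torus θ))
  add_smul p q a := Subtype.ext (add_mul (p : Torus θ) (q : Torus θ) (a : Torus θ))
  zero_smul a := Subtype.ext (zero_mul (a : Torus θ))

/-- `𝒪(𝕋²_θ)₋` as a right `𝒪(ℙ_θ)`-module, i.e. a module over the opposite algebra:
`op p • a = a p`. -/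
instance rightModule (θ : ℝ) : Module (Pillow θ)ᵐᵒᵖ (OddPart θ) where
  smul p a := ⟨(a : Torus θ) * (p.unop : Torus θ), odd_mul_pillow p.unop.2 a.2⟩
  one_smul a := Subtype.ext (mul_one (a : Torus θ))
  mul_smul p q a :=
    Subtype.ext (mul_assoc (a : Torus θ) (q.unop : Torus θ) (p.unop : Torus θ)).symm
  smul_zero p := Subtype.ext (zero_mul (p.unop : Torus θ))
  smul_add p a b := Subtype.ext (add_mul (a : Torus θ) (b : Torus θ) (p.unop : Torus θ))
  add_smul p q a := Subtype.ext (mul_add (a : Torus θ) (p.unop : Torus θ) (q.unop : Torus θ))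
  zero_smul a := Subtype.ext (mul_zero (a : Torus θ))

/-- The module of one-forms (sections of the cotangent bundle)
`Ω¹(ℙ_θ) = 𝒪(𝕋²_θ)₋ ⊕ 𝒪(𝕋²_θ)₋`, with the componentwise left and right actions. -/
abbrev Omega1 (θ : ℝ) : Type := OddPart θ × OddPart θ

theorem sigma_gen (θ : ℝ) (g : Gen) : sigma θ (gen θ g) = gen θ g.swap :=
  lift_gen θ _ _ g

theorem sigma_V (θ : ℝ) : sigma θ (V θ : Torus θ) = ((V θ)⁻¹ : (Torus θ)ˣ) := sigma_gen θ Gen.V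

theorem sigma_V_inv (θ : ℝ) : sigma θ (((V θ)⁻¹ : (Torus θ)ˣ) : Torus θ) = V θ :=
  sigma_gen θ Gen.Vs

theorem sigma_W (θ : ℝ) : sigma θ (W θ : Torus θ) = ((W θ)⁻¹ : (Torus θ)ˣ) := sigma_gen θ Gen.W

theorem sigma_W_inv (θ : ℝ) : sigma θ (((W θ)⁻¹ : (Torus θ)ˣ) : Torus θ) = W θ :=
  sigma_gen θ Gen.Ws

/-- `z = V W* + V* W`. -/
def z (θ : ℝ) : Pillow θ :=
  ⟨(V θ : Torus θ) * ((W θ)⁻¹ : (Torus θ)ˣ) + ((V θ)⁻¹ : (Torus θ)ˣ) * (W θ : Torus θ), by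
    rw [mem_pillow, map_add, map_mul, map_mul, sigma_V, sigma_W_inv, sigma_V_inv, sigma_W,
      add_comm]⟩

/-- `x̂ = V - V*`. -/
def xHat (θ : ℝ) : OddPart θ :=
  ⟨(V θ : Torus θ) - ((V θ)⁻¹ : (Torus θ)ˣ), by
    rw [mem_odd, map_sub, sigma_V, sigma_V_inv, neg_sub]⟩

/-- `ŷ = W - W*`. -/
def yHat (θ : ℝ) : OddPart θ :=
  ⟨(W θ : Torus θ) - ((W θ)⁻¹ : (Torus θ)ˣ), by
    rw [mem_odd, map_sub, sigma_W, sigma_W_inv, neg_sub]⟩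

/-- `ẑ = V W* - V* W`. -/
def zHat (θ : ℝ) : OddPart θ :=
  ⟨(V θ : Torus θ) * ((W θ)⁻¹ : (Torus θ)ˣ) - ((V θ)⁻¹ : (Torus θ)ˣ) * (W θ : Torus θ), by
    rw [mem_odd, map_sub, map_mul, map_mul, sigma_V, sigma_W_inv, sigma_V_inv, sigma_W, neg_sub]⟩

/-- The product of two odd elements, as an element of the pillow algebra. -/
def oddMul {θ : ℝ} (a b : OddPart θ) : Pillow θ :=
  ⟨(a : Torus θ) * (b : Torus θ), odd_mul_odd a.2 b.2⟩

/-- The column `(x̂, ŷ, ẑ)ᵀ`. -/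
def col (θ : ℝ) : Fin 3 → OddPart θ := ![xHat θ, yHat θ, zHat θ]

/-- The row `(x̂, ŷ - x̂ z, -λ̄ ẑ)`. -/
def row (θ : ℝ) : Fin 3 → OddPart θ :=
  ![xHat θ, yHat θ - MulOpposite.op (z θ) • xHat θ, -((starRingEnd ℂ) (lam θ) • zHat θ)]

/-- The `3 × 3` matrix `e = (2(λ̄² - 1))⁻¹ (x̂, ŷ, ẑ)ᵀ (x̂, ŷ - x̂ z, -λ̄ ẑ)` over `𝒪(ℙ_θ)`. -/
def e (θ : ℝ) : Matrix (Fin 3) (Fin 3) (Pillow θ) :=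
  Matrix.of fun i j =>
    (1 / (2 * ((starRingEnd ℂ) (lam θ) ^ 2 - 1))) • oddMul (col θ i) (row θ j)

/-- The left submodule `𝒪(ℙ_θ)³ e` of the free left module of row vectors. -/
def leftImage (θ : ℝ) : Submodule (Pillow θ) (Fin 3 → Pillow θ) where
  carrier := {w | ∃ v : Fin 3 → Pillow θ, w = Matrix.vecMul v (e θ)}
  add_mem' := by
    rintro _ _ ⟨v, rfl⟩ ⟨w, rfl⟩
    exact ⟨v + w, (Matrix.add_vecMul _ _ _).symm⟩
  zero_mem' := ⟨0, (Matrix.zero_vecMul _).symm⟩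
  smul_mem' := by
    rintro p _ ⟨v, rfl⟩
    exact ⟨p • v, (Matrix.smul_vecMul _ _ _).symm⟩

/-- The right submodule `e 𝒪(ℙ_θ)³` of the free right module of column vectors. -/
def rightImage (θ : ℝ) : Submodule (Pillow θ)ᵐᵒᵖ (Fin 3 → Pillow θ) where
  carrier := {w | ∃ v : Fin 3 → Pillow θ, w = Matrix.mulVec (e θ) v}
  add_mem' := by
    rintro _ _ ⟨v, rfl⟩ ⟨w, rfl⟩
    exact ⟨v + w, (Matrix.mulVec_add _ _ _).symm⟩
  zero_mem' := ⟨0, (Matrix.mulVec_zero _).symm⟩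
  smul_mem' := by
    rintro p _ ⟨v, rfl⟩
    exact ⟨p • v, (Matrix.mulVec_smul _ _ _).symm⟩

/-- `τ` takes the values `τ(V^α W^β) = exp(πiθαβ)` if `α ≡ i` and `β ≡ j` modulo `2`, and `0`
otherwise. -/
def HasTraceValues (θ : ℝ) (i j : ZMod 2) (τ : Torus θ →ₗ[ℂ] ℂ) : Prop :=
  ∀ α β : ℤ, τ ((V θ ^ α * W θ ^ β : (Torus θ)ˣ) : Torus θ) =
    if (α : ZMod 2) = i ∧ (β : ZMod 2) = j then
      Complex.exp (Real.pi * Complex.I * θ * α * β) else 0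

end

end NCPillow

namespace NCPillow

noncomputable section

/-! ### Dual bases and the rank trace -/

section DualBasis

variable {R M ι κ : Type*} [Ring R] [AddCommGroup M] [Module R M] [Fintype ι] [Fintype κ]

/-! Everything rests on one identity: the row times the column is the scalar `2(λ̄² - 1)`, nonzero
because `λ² ≠ 1`. After normalisation, row times column is 1 (`sum_normRow_mul_col`), so column
times row, which is `e`, is idempotent. By associativity, every odd `a` equals `∑ (a r_j) c_j` and
`∑ r_j (c_j a)`. These are finite dual bases of the odd part on the left and on the right, giving
finite generation, projectivity and the identification with the images of `e`.

Odd elements anticommute under a twisted trace: `τ(c r) = τ(σ(r) c) = -τ(r c)`. Hence `τ(Tr e) =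
-τ(1)`, which is -1 for `τ̂₀₀` and 0 for the other three. On the pillow algebra `σ` is the identity,
so `τ̂₀₀` is an honest normalised trace there. On any dual basis of a free module such a trace is a
natural number, whereas here it is -1, and -2 on the direct sum of two copies. -/

theorem finite_of_dualBasis (x : ι → M) (φ : ι → M →ₗ[R] R) (h : ∀ m, ∑ i, φ i m • x i = m) :
    Module.Finite R M :=
  Module.Finite.of_surjective (Fintype.linearCombination R x) fun m =>
    ⟨fun i => φ i m, by rw [Fintype.linearCombination_apply, h]⟩

theorem projective_of_dualBasis (x : ι → M) (φ : ι → M →ₗ[R] R)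
    (h : ∀ m, ∑ i, φ i m • x i = m) : Module.Projective R M :=
  Module.Projective.of_split (LinearMap.pi φ) (Fintype.linearCombination R x) <| by
    ext m
    simp [Fintype.linearCombination_apply, h]

/-- A trace takes the same value on the idempotents of any two finite dual bases of a module. -/
theorem trace_dualBasis_eq {A : Type*} [AddCommMonoid A] (t : R →+ A)
    (ht : ∀ a b, t (a * b) = t (b * a))
    (x : ι → M) (φ : ι → M →ₗ[R] R) (h : ∀ m, ∑ i, φ i m • x i = m)
    (y : κ → M) (ψ : κ → M →ₗ[R] R) (k : ∀ m, ∑ j, ψ j m • y j = m) :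
    ∑ i, t (φ i (x i)) = ∑ j, t (ψ j (y j)) := by
  calc ∑ i, t (φ i (x i)) = ∑ i, ∑ j, t (ψ j (x i) * φ i (y j)) := by
        refine Finset.sum_congr rfl fun i _ => ?_
        -- Expanding `x i` in the second dual basis gives `φ i (x i) = ∑ j, ψ j (x i) * φ i (y j)`.
        conv_lhs => rw [← k (x i)]
        simp
    _ = ∑ j, ∑ i, t (φ i (y j) * ψ j (x i)) := by
        rw [Finset.sum_comm]
        exact Finset.sum_congr rfl fun j _ => Finset.sum_congr rfl fun i _ => ht _ _
    _ = ∑ j, t (ψ j (y j)) := by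
        refine Finset.sum_congr rfl fun j _ => ?_
        conv_rhs => rw [← h (y j)]
        simp

/-- If the module is free, the value of a trace on a dual basis is a multiple of its value at `1`. -/
theorem exists_trace_eq_nsmul_of_free {A : Type*} [AddCommMonoid A] (t : R →+ A)
    (ht : ∀ a b, t (a * b) = t (b * a))
    (x : ι → M) (φ : ι → M →ₗ[R] R) (h : ∀ m, ∑ i, φ i m • x i = m) (hM : Module.Free R M) :
    ∃ n : ℕ, ∑ i, t (φ i (x i)) = n • t 1 := by
  have := finite_of_dualBasis x φ h
  let b := Module.Free.chooseBasis R M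
  refine ⟨Fintype.card (Module.Free.ChooseBasisIndex R M), ?_⟩
  rw [trace_dualBasis_eq t ht x φ h b (fun j => b.coord j) fun m => by simp]
  simp

/-- A module with a dual basis on which a normalized trace is negative is not free, and neither is
its direct sum with itself. -/
theorem not_free_of_trace_eq_neg_one (t : R →+ ℂ) (ht : ∀ a b, t (a * b) = t (b * a))
    (ht1 : t 1 = 1) (x : ι → M) (φ : ι → M →ₗ[R] R) (h : ∀ m, ∑ i, φ i m • x i = m)
    (hx : ∑ i, t (φ i (x i)) = -1) :
    ¬ Module.Free R M ∧ ¬ Module.Free R (M × M) := by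
  constructor
  · intro hM
    obtain ⟨n, hn⟩ := exists_trace_eq_nsmul_of_free t ht x φ h hM
    rw [hx, ht1, nsmul_one] at hn
    have : (n : ℝ) = -1 := by exact_mod_cast hn.symm
    linarith [n.cast_nonneg (α := ℝ)]
  · intro hM
    obtain ⟨n, hn⟩ := exists_trace_eq_nsmul_of_free (ι := ι ⊕ ι) t ht
      -- Two copies of the dual basis, one per summand, double the trace to -2.
      (Sum.elim (fun i => (x i, 0)) fun i => (0, x i))
      (Sum.elim (fun i => φ i ∘ₗ LinearMap.fst R M M) fun i => φ i ∘ₗ LinearMap.snd R M M)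
      (fun m => by ext <;> simp [Prod.fst_sum, Prod.snd_sum, h]) hM
    simp only [Fintype.sum_sum_type, Sum.elim_inl, Sum.elim_inr, LinearMap.comp_apply,
      LinearMap.fst_apply, LinearMap.snd_apply, hx, ht1, nsmul_one] at hn
    have : (n : ℝ) = -1 + -1 := by exact_mod_cast hn.symm
    linarith [n.cast_nonneg (α := ℝ)]

end DualBasis

/-! ### Monomials -/

/-- Conjugation by `v` scales `w` by the central `c`, hence `w ^ b` by `c ^ b`. Conjugation by `w ^
b` therefore scales `v` by `c ^ (-b)`; then take `a`-th powers. -/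
theorem zpow_mul_zpow_of_mul_eq {G : Type*} [Group G] {v w c : G} (hc : ∀ g, Commute c g)
    (h : v * w = c * (w * v)) (a b : ℤ) : v ^ a * w ^ b = c ^ (a * b) * (w ^ b * v ^ a) := by
  have h1 : v * w * v⁻¹ = c * w := by rw [h]; group
  have h2 (b : ℤ) : v * w ^ b * v⁻¹ = c ^ b * w ^ b := by
    rw [← conj_zpow, h1, (hc w).mul_zpow]
  have h3 : w ^ b * v * (w ^ b)⁻¹ = c ^ (-b) * v := by
    have h4 : v * w ^ b = c ^ b * w ^ b * v := by rw [← h2 b]; group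
    have h5 : w ^ b * v = c ^ (-b) * (v * w ^ b) := by rw [h4]; group
    rw [h5]; group
  have h6 : w ^ b * v ^ a * (w ^ b)⁻¹ = c ^ (-b * a) * v ^ a := by
    rw [← conj_zpow, h3, ((hc v).zpow_left _).mul_zpow, zpow_mul]
  have h7 : w ^ b * v ^ a = c ^ (-b * a) * v ^ a * w ^ b := by rw [← h6]; group
  rw [h7, mul_assoc, ← mul_assoc, ← zpow_add]
  have : a * b + -b * a = 0 := by ring
  rw [this]; simp

theorem lam_ne_zero (θ : ℝ) : lam θ ≠ 0 := Complex.exp_ne_zero _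

theorem conj_lam (θ : ℝ) : (starRingEnd ℂ) (lam θ) = (lam θ)⁻¹ := by
  rw [lam, ← Complex.exp_conj, ← Complex.exp_neg]
  simp [Complex.conj_ofNat]

theorem lam_zpow (θ : ℝ) (n : ℤ) : lam θ ^ n = Complex.exp (2 * Real.pi * Complex.I * θ * n) := by
  rw [lam, ← Complex.exp_int_mul]
  ring_nf

/-- Otherwise `2θ` would be an integer. Irrationality enters the whole argument only here. -/
theorem lam_sq_ne_one {θ : ℝ} (hθ : Irrational θ) : lam θ ^ 2 ≠ 1 := by
  intro h
  have h1 : lam θ ^ (2 : ℤ) = 1 := by exact_mod_cast h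
  rw [lam_zpow, Complex.exp_eq_one_iff] at h1
  obtain ⟨n, hn⟩ := h1
  have h2 : (2 * Real.pi * Complex.I : ℂ) ≠ 0 := Complex.two_pi_I_ne_zero
  have h3 : ((θ * 2 : ℝ) : ℂ) = ((n : ℝ) : ℂ) := by
    apply mul_left_cancel₀ h2
    push_cast at hn ⊢
    linear_combination hn
  have h4 : Irrational (θ * ((2 : ℕ) : ℝ)) := hθ.mul_natCast two_ne_zero
  exact h4.ne_int n (by exact_mod_cast h3)

/-- The monomial `V^α W^β`. -/
def mono (θ : ℝ) (α β : ℤ) : Torus θ := ((V θ ^ α * W θ ^ β : (Torus θ)ˣ) : Torus θ)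

/-- The deformation parameter as a unit of the noncommutative torus. -/
def lamUnit (θ : ℝ) : (Torus θ)ˣ :=
  Units.map (algebraMap ℂ (Torus θ)).toMonoidHom (Units.mk0 (lam θ) (lam_ne_zero θ))

theorem coe_lamUnit_zpow (θ : ℝ) (n : ℤ) :
    ((lamUnit θ ^ n : (Torus θ)ˣ) : Torus θ) = algebraMap ℂ (Torus θ) (lam θ ^ n) := by
  rw [lamUnit, ← map_zpow, Units.coe_map]
  simp

theorem lamUnit_commute (θ : ℝ) (g : (Torus θ)ˣ) : Commute (lamUnit θ) g :=
  Units.ext (Algebra.commutes (lam θ) (g : Torus θ))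

theorem V_mul_W (θ : ℝ) : V θ * W θ = lamUnit θ * (W θ * V θ) :=
  Units.ext ((gen_V_W θ).trans (Algebra.smul_def _ _))

theorem W_zpow_mul_V_zpow (θ : ℝ) (α β : ℤ) :
    W θ ^ β * V θ ^ α = lamUnit θ ^ (-(α * β)) * (V θ ^ α * W θ ^ β) := by
  rw [zpow_mul_zpow_of_mul_eq (lamUnit_commute θ) (V_mul_W θ) α β, ← mul_assoc, ← zpow_add]
  simp

theorem mono_mul_mono (θ : ℝ) (a b c d : ℤ) :
    mono θ a b * mono θ c d = lam θ ^ (-(c * b)) • mono θ (a + c) (b + d) := by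
  rw [Algebra.smul_def, ← coe_lamUnit_zpow]
  simp only [mono, ← Units.val_mul]
  congr 1
  calc V θ ^ a * W θ ^ b * (V θ ^ c * W θ ^ d)
      = V θ ^ a * (W θ ^ b * V θ ^ c) * W θ ^ d := by group
    _ = (V θ ^ a * lamUnit θ ^ (-(c * b))) * (V θ ^ c * W θ ^ b) * W θ ^ d := by
        rw [W_zpow_mul_V_zpow]; simp only [mul_assoc]
    _ = lamUnit θ ^ (-(c * b)) * (V θ ^ (a + c) * W θ ^ (b + d)) := by
        rw [← ((lamUnit_commute θ (V θ ^ a)).zpow_left _).eq, zpow_add, zpow_add]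
        simp only [mul_assoc]

theorem mono_zero_zero (θ : ℝ) : mono θ 0 0 = 1 := by simp [mono]

theorem V_eq_mono (θ : ℝ) : (V θ : Torus θ) = mono θ 1 0 := by simp [mono]

theorem V_inv_eq_mono (θ : ℝ) : (((V θ)⁻¹ : (Torus θ)ˣ) : Torus θ) = mono θ (-1) 0 := by
  simp [mono]

theorem W_eq_mono (θ : ℝ) : (W θ : Torus θ) = mono θ 0 1 := by simp [mono]

theorem W_inv_eq_mono (θ : ℝ) : (((W θ)⁻¹ : (Torus θ)ˣ) : Torus θ) = mono θ 0 (-1) := by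
  simp [mono]

theorem sigma_mono (θ : ℝ) (a b : ℤ) : sigma θ (mono θ a b) = mono θ (-a) (-b) := by
  have hV : Units.map (sigma θ : Torus θ →* Torus θ) (V θ) = (V θ)⁻¹ := Units.ext (sigma_V θ)
  have hW : Units.map (sigma θ : Torus θ →* Torus θ) (W θ) = (W θ)⁻¹ := Units.ext (sigma_W θ)
  have h : Units.map (sigma θ : Torus θ →* Torus θ) (V θ ^ a * W θ ^ b)
      = V θ ^ (-a) * W θ ^ (-b) := by
    rw [map_mul, map_zpow, map_zpow, hV, hW, inv_zpow', inv_zpow']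
  exact congrArg Units.val h

theorem gen_eq_mono (θ : ℝ) (g : Gen) : ∃ a b, gen θ g = mono θ a b := by
  cases g
  · exact ⟨_, _, V_eq_mono θ⟩
  · exact ⟨_, _, V_inv_eq_mono θ⟩
  · exact ⟨_, _, W_eq_mono θ⟩
  · exact ⟨_, _, W_inv_eq_mono θ⟩

/-- The span contains 1 and the generators and is closed under products. A functional is thus
determined by its values on monomials, whence uniqueness of the traces. -/
theorem span_mono (θ : ℝ) :
    Submodule.span ℂ (Set.range fun p : ℤ × ℤ => mono θ p.1 p.2) = ⊤ := by
  set S := Submodule.span ℂ (Set.range fun p : ℤ × ℤ => mono θ p.1 p.2)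
  have hmono (a b) : mono θ a b ∈ S := Submodule.subset_span ⟨(a, b), rfl⟩
  have hmul (x y) (hx : x ∈ S) (hy : y ∈ S) : x * y ∈ S := by
    induction hx using Submodule.span_induction with
    | mem x hx =>
      obtain ⟨p, rfl⟩ := hx
      induction hy using Submodule.span_induction with
      | mem y hy =>
        obtain ⟨q, rfl⟩ := hy
        simp only [mono_mul_mono]
        exact S.smul_mem _ (hmono _ _)
      | zero => rw [mul_zero]; exact S.zero_mem
      | add _ _ _ _ h1 h2 => rw [mul_add]; exact S.add_mem h1 h2
      | smul r _ _ h => rw [mul_smul_comm]; exact S.smul_mem r h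
    | zero => rw [zero_mul]; exact S.zero_mem
    | add _ _ _ _ h1 h2 => rw [add_mul]; exact S.add_mem h1 h2
    | smul r _ _ h => rw [smul_mul_assoc]; exact S.smul_mem r h
  have h1 : (1 : Torus θ) ∈ S := mono_zero_zero θ ▸ hmono 0 0
  refine eq_top_iff.2 fun x hx => ?_
  clear hx
  obtain ⟨x, rfl⟩ := RingQuot.mkAlgHom_surjective ℂ (Rel θ) x
  change mk θ x ∈ S
  induction x using FreeAlgebra.induction with
  | grade0 r => rw [AlgHom.commutes, Algebra.algebraMap_eq_smul_one]; exact S.smul_mem r h1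
  | grade1 g =>
    obtain ⟨a, b, h⟩ := gen_eq_mono θ g
    change gen θ g ∈ S
    exact h ▸ hmono a b
  | mul x y hx hy => rw [map_mul]; exact hmul _ _ hx hy
  | add x y hx hy => rw [map_add]; exact S.add_mem hx hy

theorem linearMap_ext_mono {θ : ℝ} {N : Type*} [AddCommMonoid N] [Module ℂ N]
    {f g : Torus θ →ₗ[ℂ] N} (h : ∀ a b, f (mono θ a b) = g (mono θ a b)) : f = g :=
  LinearMap.ext_on_range (span_mono θ) fun p => h p.1 p.2

/-! ### The twisted traces -/

/-- The translation `(V f)(a, b) = f (a + n, b)` of functions on `ℤ²`. -/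
def shiftV (n : ℤ) : (ℤ → ℤ → ℂ) →ₗ[ℂ] (ℤ → ℤ → ℂ) where
  toFun f a b := f (a + n) b
  map_add' _ _ := rfl
  map_smul' _ _ := rfl

/-- The modulated translation `(W f)(a, b) = λ^(a n) f (a, b + n)` of functions on `ℤ²`. -/
def shiftW (θ : ℝ) (n : ℤ) : (ℤ → ℤ → ℂ) →ₗ[ℂ] (ℤ → ℤ → ℂ) where
  toFun f a b := lam θ ^ (a * n) * f a (b + n)
  map_add' _ _ := by ext; simp [mul_add]
  map_smul' _ _ := by ext; simp [mul_left_comm]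

theorem shiftV_mul (m n : ℤ) : shiftV m * shiftV n = shiftV (m + n) := by
  ext f a b
  simp [shiftV, Module.End.mul_apply, add_assoc]

theorem shiftV_zero : shiftV 0 = 1 := by
  ext f a b
  simp [shiftV]

theorem shiftW_mul (θ : ℝ) (m n : ℤ) : shiftW θ m * shiftW θ n = shiftW θ (m + n) := by
  ext f a b
  simp [shiftW, Module.End.mul_apply, add_assoc, mul_add, zpow_add₀ (lam_ne_zero θ), mul_assoc]

theorem shiftW_zero (θ : ℝ) : shiftW θ 0 = 1 := by
  ext f a b
  simp [shiftW]

theorem shiftV_mul_shiftW (θ : ℝ) :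
    shiftV 1 * shiftW θ 1 = lam θ • (shiftW θ 1 * shiftV 1) := by
  ext f a b
  simp [shiftV, shiftW, Module.End.mul_apply, zpow_add₀ (lam_ne_zero θ)]
  ring

/-- The representation of the noncommutative torus on functions on `ℤ²`. -/
def rep (θ : ℝ) : Torus θ →ₐ[ℂ] Module.End ℂ (ℤ → ℤ → ℂ) :=
  lift θ (fun
    | Gen.V => shiftV 1
    | Gen.Vs => shiftV (-1)
    | Gen.W => shiftW θ 1
    | Gen.Ws => shiftW θ (-1)) (by
    intro x y h
    cases h <;>
      simp [shiftV_mul, shiftW_mul, shiftV_zero, shiftW_zero, shiftV_mul_shiftW])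

theorem rep_V_zpow (θ : ℝ) (n : ℤ) : rep θ ((V θ ^ n : (Torus θ)ˣ) : Torus θ) = shiftV n := by
  have hV : rep θ (V θ : Torus θ) = shiftV 1 := lift_gen θ _ _ Gen.V
  have hV' : rep θ (((V θ)⁻¹ : (Torus θ)ˣ) : Torus θ) = shiftV (-1) := lift_gen θ _ _ Gen.Vs
  induction n with
  | zero => simp [shiftV_zero]
  | succ n ih => rw [zpow_add_one, Units.val_mul, map_mul, ih, hV, shiftV_mul]
  | pred n ih => rw [zpow_sub_one, Units.val_mul, map_mul, ih, hV', shiftV_mul]; rfl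

theorem rep_W_zpow (θ : ℝ) (n : ℤ) : rep θ ((W θ ^ n : (Torus θ)ˣ) : Torus θ) = shiftW θ n := by
  have hW : rep θ (W θ : Torus θ) = shiftW θ 1 := lift_gen θ _ _ Gen.W
  have hW' : rep θ (((W θ)⁻¹ : (Torus θ)ˣ) : Torus θ) = shiftW θ (-1) := lift_gen θ _ _ Gen.Ws
  induction n with
  | zero => simp [shiftW_zero]
  | succ n ih => rw [zpow_add_one, Units.val_mul, map_mul, ih, hW, shiftW_mul]
  | pred n ih => rw [zpow_sub_one, Units.val_mul, map_mul, ih, hW', shiftW_mul]; rfl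

/-- The prescribed value of a twisted trace at `V^α W^β`. -/
def traceValue (θ : ℝ) (i j : ZMod 2) (α β : ℤ) : ℂ :=
  if (α : ZMod 2) = i ∧ (β : ZMod 2) = j then
    Complex.exp (Real.pi * Complex.I * θ * α * β) else 0

/-- The twisted trace `τ̂_ij`, a matrix coefficient of the representation on functions on `ℤ²`. -/
def twistedTrace (θ : ℝ) (i j : ZMod 2) : Torus θ →ₗ[ℂ] ℂ where
  -- At the origin, `V^α W^β` sends `f` to `λ^(αβ) f(α, β)`; the factor `λ^(-ab)` cancels that
  -- power.
  toFun x := rep θ x (fun a b => lam θ ^ (-(a * b)) * traceValue θ i j a b) 0 0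
  map_add' x y := by simp
  map_smul' c x := by simp

theorem twistedTrace_mono (θ : ℝ) (i j : ZMod 2) (α β : ℤ) :
    twistedTrace θ i j (mono θ α β) = traceValue θ i j α β := by
  have h : lam θ ^ (α * β) ≠ 0 := zpow_ne_zero _ (lam_ne_zero θ)
  simp [twistedTrace, mono, rep_V_zpow, rep_W_zpow, shiftV, shiftW, h]

theorem hasTraceValues_twistedTrace (θ : ℝ) (i j : ZMod 2) :
    HasTraceValues θ i j (twistedTrace θ i j) :=
  twistedTrace_mono θ i j

theorem eq_twistedTrace {θ : ℝ} {i j : ZMod 2} {τ : Torus θ →ₗ[ℂ] ℂ}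
    (h : HasTraceValues θ i j τ) : τ = twistedTrace θ i j :=
  linearMap_ext_mono fun a b => (h a b).trans (twistedTrace_mono θ i j a b).symm

/-- By bilinearity, monomials suffice. For `x = V^a W^b`, `y = V^c W^d`, both sides have phase
`exp(πiθ(ab + ad - bc + cd))`, and `σ` preserves exponents modulo 2. -/
theorem twistedTrace_mul (θ : ℝ) (i j : ZMod 2) (x y : Torus θ) :
    twistedTrace θ i j (x * y) = twistedTrace θ i j (sigma θ y * x) := by
  have key : (LinearMap.mul ℂ (Torus θ)).compr₂ (twistedTrace θ i j)
      = ((LinearMap.mul ℂ (Torus θ)).flip.compl₂ (sigma θ).toLinearMap).compr₂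
          (twistedTrace θ i j) := by
    refine linearMap_ext_mono fun a b => linearMap_ext_mono fun c d => ?_
    simp only [LinearMap.compr₂_apply, LinearMap.mul_apply', LinearMap.compl₂_apply,
      LinearMap.flip_apply, AlgHom.toLinearMap_apply, sigma_mono, mono_mul_mono, map_smul,
      twistedTrace_mono, traceValue, smul_eq_mul]
    have e1 : ((-c + a : ℤ) : ZMod 2) = ((a + c : ℤ) : ZMod 2) := by
      push_cast; rw [ZMod.neg_eq_self_mod_two, add_comm]
    have e2 : ((-d + b : ℤ) : ZMod 2) = ((b + d : ℤ) : ZMod 2) := by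
      push_cast; rw [ZMod.neg_eq_self_mod_two, add_comm]
    rw [e1, e2]
    split_ifs
    · rw [lam_zpow, lam_zpow, ← Complex.exp_add, ← Complex.exp_add]
      congr 1
      push_cast
      ring
    · simp
  exact LinearMap.congr_fun₂ key x y

theorem twistedTrace_one (θ : ℝ) (i j : ZMod 2) :
    twistedTrace θ i j 1 = if 0 = i ∧ 0 = j then 1 else 0 := by
  rw [← mono_zero_zero, twistedTrace_mono]
  simp [traceValue]

/-- The restriction of the twisted trace `τ̂₀₀` to the pillow algebra, where it is a trace. -/
def pillowTrace (θ : ℝ) : Pillow θ →+ ℂ :=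
  (twistedTrace θ 0 0).toAddMonoidHom.comp (Pillow θ).val.toAddMonoidHom

theorem pillowTrace_apply (θ : ℝ) (p : Pillow θ) :
    pillowTrace θ p = twistedTrace θ 0 0 (p : Torus θ) := rfl

theorem pillowTrace_mul_comm (θ : ℝ) (p q : Pillow θ) :
    pillowTrace θ (p * q) = pillowTrace θ (q * p) := by
  simp only [pillowTrace_apply, MulMemClass.coe_mul]
  rw [twistedTrace_mul, mem_pillow.1 q.2]

theorem pillowTrace_one (θ : ℝ) : pillowTrace θ 1 = 1 := by
  simp [pillowTrace_apply, twistedTrace_one]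

end

end NCPillow

namespace NCPillow

noncomputable section

/-! ### The dual basis of the odd part -/

/-- The row `(x̂, ŷ - x̂ z, -λ̄ ẑ)` divided by `2 (λ̄² - 1)`. -/
def normRow (θ : ℝ) (j : Fin 3) : OddPart θ :=
  (1 / (2 * ((starRingEnd ℂ) (lam θ) ^ 2 - 1))) • row θ j

theorem e_apply (θ : ℝ) (i j : Fin 3) : e θ i j = oddMul (col θ i) (normRow θ j) :=
  Subtype.ext (mul_smul_comm _ _ _).symm

/-- The only computation specific to the chosen row and column: expand in ordered monomials and
compare scalar coefficients. -/
theorem sum_row_mul_col (θ : ℝ) :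
    ∑ j, (row θ j : Torus θ) * (col θ j : Torus θ)
      = (2 * ((starRingEnd ℂ) (lam θ) ^ 2 - 1)) • (1 : Torus θ) := by
  have h0 : lam θ * (lam θ)⁻¹ = 1 := mul_inv_cancel₀ (lam_ne_zero θ)
  have hz : ((MulOpposite.op (z θ) • xHat θ : OddPart θ) : Torus θ)
      = (xHat θ : Torus θ) * (z θ : Torus θ) := rfl
  simp only [Fin.sum_univ_three, row, col, Matrix.cons_val_zero, Matrix.cons_val_one,
    Matrix.cons_val, Submodule.coe_sub, Submodule.coe_neg, Submodule.coe_smul, hz, conj_lam]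
  simp only [xHat, yHat, zHat, z, V_eq_mono, V_inv_eq_mono, W_eq_mono, W_inv_eq_mono,
    mono_mul_mono, mul_add, mul_sub, add_mul, sub_mul, smul_mul_assoc, mul_smul_comm,
    neg_mul, ← mono_zero_zero]
  norm_num [mono_mul_mono, smul_sub, smul_smul]
  match_scalars <;> first | ring1 | linear_combination h0 | linear_combination -h0

theorem sum_normRow_mul_col {θ : ℝ} (hθ : Irrational θ) :
    ∑ j, (normRow θ j : Torus θ) * (col θ j : Torus θ) = 1 := by
  have h : 2 * ((starRingEnd ℂ) (lam θ) ^ 2 - 1) ≠ 0 := by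
    refine mul_ne_zero two_ne_zero (sub_ne_zero.2 fun h => lam_sq_ne_one hθ ?_)
    rwa [conj_lam, inv_pow, inv_eq_one] at h
  simp only [normRow, Submodule.coe_smul, smul_mul_assoc]
  rw [← Finset.smul_sum, sum_row_mul_col, smul_smul, one_div_mul_cancel h, one_smul]

theorem coe_left_smul {θ : ℝ} (p : Pillow θ) (a : OddPart θ) :
    ((p • a : OddPart θ) : Torus θ) = (p : Torus θ) * (a : Torus θ) := rfl

theorem coe_right_smul {θ : ℝ} (p : (Pillow θ)ᵐᵒᵖ) (a : OddPart θ) :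
    ((p • a : OddPart θ) : Torus θ) = (a : Torus θ) * (p.unop : Torus θ) := rfl

theorem coe_oddMul {θ : ℝ} (a b : OddPart θ) :
    (oddMul a b : Torus θ) = (a : Torus θ) * (b : Torus θ) := rfl

/-- Right multiplication by an odd element, a left module map to the pillow algebra. -/
def leftCoord {θ : ℝ} (b : OddPart θ) : OddPart θ →ₗ[Pillow θ] Pillow θ where
  toFun a := oddMul a b
  map_add' _ _ := Subtype.ext (add_mul _ _ _)
  map_smul' _ _ := Subtype.ext (mul_assoc _ _ _)

/-- Left multiplication by an odd element, a right module map to the pillow algebra. -/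
def rightCoord {θ : ℝ} (b : OddPart θ) : OddPart θ →ₗ[(Pillow θ)ᵐᵒᵖ] Pillow θ where
  toFun a := oddMul b a
  map_add' _ _ := Subtype.ext (mul_add _ _ _)
  map_smul' _ _ := Subtype.ext (mul_assoc _ _ _).symm

/-- The pillow algebra as a right module over itself, identified with its opposite algebra. -/
def opRight (θ : ℝ) : Pillow θ →ₗ[(Pillow θ)ᵐᵒᵖ] (Pillow θ)ᵐᵒᵖ where
  toFun := MulOpposite.op
  map_add' _ _ := rfl
  map_smul' _ _ := rfl

theorem sum_leftCoord_smul {θ : ℝ} (hθ : Irrational θ) (a : OddPart θ) :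
    ∑ j, leftCoord (normRow θ j) a • col θ j = a := by
  refine Subtype.ext ?_
  rw [Submodule.coe_sum]
  simp only [coe_left_smul, leftCoord, LinearMap.coe_mk, AddHom.coe_mk, coe_oddMul, mul_assoc]
  rw [← Finset.mul_sum, sum_normRow_mul_col hθ, mul_one]

theorem sum_rightCoord_smul {θ : ℝ} (hθ : Irrational θ) (a : OddPart θ) :
    ∑ j, (opRight θ ∘ₗ rightCoord (col θ j)) a • normRow θ j = a := by
  refine Subtype.ext ?_
  rw [Submodule.coe_sum]
  simp only [coe_right_smul, opRight, rightCoord, LinearMap.comp_apply, LinearMap.coe_mk,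
    AddHom.coe_mk, coe_oddMul, MulOpposite.unop_op, ← mul_assoc]
  rw [← Finset.sum_mul, sum_normRow_mul_col hθ, one_mul]

/-! ### Trace of the idempotent and non-freeness -/

theorem twistedTrace_trace_e {θ : ℝ} (hθ : Irrational θ) (i j : ZMod 2) :
    twistedTrace θ i j (Matrix.trace (e θ) : Pillow θ) = -twistedTrace θ i j 1 := by
  have h (k : Fin 3) : twistedTrace θ i j (e θ k k : Pillow θ)
      = -twistedTrace θ i j ((normRow θ k : Torus θ) * (col θ k : Torus θ)) := by
    rw [e_apply, coe_oddMul, twistedTrace_mul, mem_odd.1 (normRow θ k).2, neg_mul, map_neg]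
  rw [← sum_normRow_mul_col hθ, map_sum, ← Finset.sum_neg_distrib, Matrix.trace,
    AddSubmonoidClass.coe_finsetSum, map_sum]
  exact Finset.sum_congr rfl fun k _ => h k

theorem pillowTrace_trace_e {θ : ℝ} (hθ : Irrational θ) :
    ∑ k, pillowTrace θ (oddMul (col θ k) (normRow θ k)) = -1 := by
  have h := twistedTrace_trace_e hθ 0 0
  rw [← pillowTrace_apply, twistedTrace_one, Matrix.trace, map_sum] at h
  simpa [e_apply] using h

theorem not_free_left {θ : ℝ} (hθ : Irrational θ) :
    ¬ Module.Free (Pillow θ) (OddPart θ) ∧ ¬ Module.Free (Pillow θ) (Omega1 θ) :=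
  not_free_of_trace_eq_neg_one (pillowTrace θ) (pillowTrace_mul_comm θ) (pillowTrace_one θ) _ _
    (sum_leftCoord_smul hθ) (pillowTrace_trace_e hθ)

theorem not_free_right {θ : ℝ} (hθ : Irrational θ) :
    ¬ Module.Free (Pillow θ)ᵐᵒᵖ (OddPart θ) ∧ ¬ Module.Free (Pillow θ)ᵐᵒᵖ (Omega1 θ) :=
  not_free_of_trace_eq_neg_one
    -- A trace on a ring is also one on its opposite. In the right dual basis, row and column
    -- exchange roles, but the sum of traces is the same.
    ((pillowTrace θ).comp (MulOpposite.opAddEquiv (α := Pillow θ)).symm.toAddMonoidHom)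
    (fun p q => pillowTrace_mul_comm θ q.unop p.unop) (pillowTrace_one θ) _ _
    (sum_rightCoord_smul hθ) (pillowTrace_trace_e hθ)

/-! ### The idempotent -/

/-- Multiplication by `e` factors through the odd part: combine the column entries with coefficients
`v`, then take coordinates. -/
theorem vecMul_e (θ : ℝ) (v : Fin 3 → Pillow θ) :
    Matrix.vecMul v (e θ) = fun j => leftCoord (normRow θ j) (∑ i, v i • col θ i) := by
  ext j : 1
  rw [map_sum]
  simp only [Matrix.vecMul, dotProduct, map_smul, e_apply]
  rfl

theorem mulVec_e (θ : ℝ) (v : Fin 3 → Pillow θ) :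
    Matrix.mulVec (e θ) v
      = fun i => rightCoord (col θ i) (∑ j, MulOpposite.op (v j) • normRow θ j) := by
  ext i : 1
  rw [map_sum]
  simp only [Matrix.mulVec, dotProduct, map_smul, e_apply]
  rfl

theorem e_mul_e {θ : ℝ} (hθ : Irrational θ) : e θ * e θ = e θ := by
  refine Matrix.ext fun i j => ?_
  have h := congrFun (vecMul_e θ fun k => e θ i k) j
  -- Row `i` of `e` consists of the coordinates of `col θ i`, so recombining returns it.
  have h' : (∑ k, e θ i k • col θ k) = col θ i := by
    simp only [e_apply]
    exact sum_leftCoord_smul hθ (col θ i)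
  rw [h'] at h
  rw [e_apply θ i j]
  exact h

/-- The odd part is the left module of the idempotent. -/
def leftEquiv {θ : ℝ} (hθ : Irrational θ) : OddPart θ ≃ₗ[Pillow θ] leftImage θ :=
  LinearEquiv.ofBijective
    ((LinearMap.pi fun j => leftCoord (normRow θ j)).codRestrict (leftImage θ) fun a =>
      -- The coordinate vector of `a` is its own preimage, being fixed by `e`.
      ⟨fun j => leftCoord (normRow θ j) a, by
        rw [vecMul_e, sum_leftCoord_smul hθ]; rfl⟩)
    ⟨fun a b h => by
      rw [← sum_leftCoord_smul hθ a, ← sum_leftCoord_smul hθ b]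
      exact Finset.sum_congr rfl fun j _ =>
        congrArg (· • col θ j) (congrFun (congrArg Subtype.val h) j),
    by
      rintro ⟨_, v, rfl⟩
      exact ⟨∑ i, v i • col θ i, Subtype.ext (vecMul_e θ v).symm⟩⟩

/-- The odd part is the right module of the idempotent. -/
def rightEquiv {θ : ℝ} (hθ : Irrational θ) : OddPart θ ≃ₗ[(Pillow θ)ᵐᵒᵖ] rightImage θ :=
  LinearEquiv.ofBijective
    ((LinearMap.pi fun i => rightCoord (col θ i)).codRestrict (rightImage θ) fun a =>
      ⟨fun i => rightCoord (col θ i) a, by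
        rw [mulVec_e]
        exact congrArg (fun (b : OddPart θ) i => rightCoord (col θ i) b)
          (sum_rightCoord_smul hθ a).symm⟩)
    ⟨fun a b h => by
      rw [← sum_rightCoord_smul hθ a, ← sum_rightCoord_smul hθ b]
      exact Finset.sum_congr rfl fun j _ =>
        congrArg (fun p => MulOpposite.op p • normRow θ j) (congrFun (congrArg Subtype.val h) j),
    by
      rintro ⟨_, v, rfl⟩
      exact ⟨∑ j, MulOpposite.op (v j) • normRow θ j, Subtype.ext (mulVec_e θ v).symm⟩⟩

end

end NCPillow

open NCPillow in
theorem proposition3p4 (θ : ℝ) (hθ : Irrational θ) :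
    -- the odd part is finitely generated projective and not free, as a left and a right module
    (Module.Finite (Pillow θ) (OddPart θ) ∧ Module.Projective (Pillow θ) (OddPart θ) ∧
      ¬ Module.Free (Pillow θ) (OddPart θ)) ∧
    (Module.Finite (Pillow θ)ᵐᵒᵖ (OddPart θ) ∧ Module.Projective (Pillow θ)ᵐᵒᵖ (OddPart θ) ∧
      ¬ Module.Free (Pillow θ)ᵐᵒᵖ (OddPart θ)) ∧
    -- the idempotent `e` represents the odd part
    (e θ * e θ = e θ ∧ Nonempty (OddPart θ ≃ₗ[Pillow θ] leftImage θ) ∧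
      Nonempty (OddPart θ ≃ₗ[(Pillow θ)ᵐᵒᵖ] rightImage θ)) ∧
    -- the four twisted traces and their values on the matrix trace of `e`
    (∃ τ : ZMod 2 → ZMod 2 → (Torus θ →ₗ[ℂ] ℂ),
      (∀ i j, HasTraceValues θ i j (τ i j) ∧ ∀ τ', HasTraceValues θ i j τ' → τ' = τ i j) ∧
      (∀ i j a b, τ i j (a * b) = τ i j (sigma θ b * a)) ∧
      τ 0 0 (Matrix.trace (e θ) : Pillow θ) = -1 ∧
      τ 0 1 (Matrix.trace (e θ) : Pillow θ) = 0 ∧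
      τ 1 0 (Matrix.trace (e θ) : Pillow θ) = 0 ∧
      τ 1 1 (Matrix.trace (e θ) : Pillow θ) = 0) ∧
    -- the module of one-forms is not free on either side
    ¬ Module.Free (Pillow θ) (Omega1 θ) ∧ ¬ Module.Free (Pillow θ)ᵐᵒᵖ (Omega1 θ) := by
  refine ⟨⟨finite_of_dualBasis _ _ (sum_leftCoord_smul hθ),
      projective_of_dualBasis _ _ (sum_leftCoord_smul hθ), (not_free_left hθ).1⟩,
    ⟨finite_of_dualBasis _ _ (sum_rightCoord_smul hθ),
      projective_of_dualBasis _ _ (sum_rightCoord_smul hθ), (not_free_right hθ).1⟩,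
    ⟨e_mul_e hθ, ⟨leftEquiv hθ⟩, ⟨rightEquiv hθ⟩⟩,
    ⟨twistedTrace θ, fun i j => ⟨hasTraceValues_twistedTrace θ i j, fun _ => eq_twistedTrace⟩,
      twistedTrace_mul θ, ?_, ?_, ?_, ?_⟩,
    (not_free_left hθ).2, (not_free_right hθ).2⟩
  all_goals
    -- Since `1 = V^0 W^0`, only `τ̂₀₀` is nonzero at 1.
    rw [twistedTrace_trace_e hθ, twistedTrace_one]
    simp
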